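/- Let $(M^m,g)$ and $(N^n,h)$ be smooth Riemannian manifolds without boundary, with Levi-Civita connections $\nabla$ and $\nabla^h$, and let $R^h(U,V)W=\nabla^h_U\nabla^h_VW-\nabla^h_V\nabla^h_UW-\nabla^h_{[U,V]}W$ be the curvature tensor of $(N,h)$. For a smooth map $\varphi:M\to N$ let $\overline\nabla$ be the connection induced by $\nabla^h$ on $\varphi^{-1}TN$, let $B_\varphi(X,Y)=\overline\nabla_X(d\varphi(Y))-d\varphi(\nabla_XY)$, and let $\tau(\varphi)=\sum_{i=1}^m B_\varphi(e_i,e_i)$ be the tension field, where $\{e_i\}$ is a local orthonormal frame on $M$. The bitension field is $\tau_2(\varphi)=\overline\Delta\,\tau(\varphi)-\sum_{i=1}^m R^h(\tau(\varphi),d\varphi(e_i))\,d\varphi(e_i)$, where $\overline\Delta V=-\sum_{i=1}^m\{\overline\nabla_{e_i}\overline\nabla_{e_i}V-\overline\nabla_{\nabla_{e_i}e_i}V\}$. The map $\varphi$ is called harmonic if $\tau(\varphi)=0$, and biharmonic if $\tau_2(\varphi)=0$. Assume that the sectional curvature of $(N,h)$ is non-positive. Let $\varphi:(M,g)\to(N,h)$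 be an isometric immersion (a smooth immersion with $\varphi^*h=g$) whose tension field is parallel in the normal bundle, that is, $\overline\nabla^\perp_X\tau(\varphi)=0$ for all vector fields $X$ on $M$, where $\overline\nabla^\perp_X\xi$ is the component of $\overline\nabla_X\xi$ orthogonal to $d\varphi(TM)$. If $\varphi$ is biharmonic, then $\varphi$ is harmonic. -/

import Mathlib

open Bundle Module
open scoped Manifold ContDiff Topology

set_option linter.unusedSectionVars false

noncomputable section

namespace Biharmonic

section LeviCivita

variable {E : Type*} [NormedAddCommGroup E] [NormedSpace ℝ E] [FiniteDimensional ℝ E]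
  {H : Type*} [TopologicalSpace H] (I : ModelWithCorners ℝ E H)
  (M : Type*) [TopologicalSpace M] [ChartedSpace H M] [IsManifold I ∞ M]

/-- Every manifold carries a covariant derivative on its tangent bundle. -/
theorem exists_covariantDerivative :
    Nonempty (CovariantDerivative I E (TangentSpace I : M → Type _)) := by
  classical
  let b := Module.finBasis ℝ E
  let e (x : M) := trivializationAt E (TangentSpace I : M → Type _) x
  have hmem (x : M) : x ∈ (e x).baseSet := FiberBundle.mem_baseSet_trivializationAt E _ x
  have hd (x : M) (σ : Π x : M, TangentSpace I x)
      (hσ : MDifferentiableAt I (I.prod 𝓘(ℝ, E)) (fun y ↦ (⟨y, σ y⟩ : TangentBundle I M)) x) (i) :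
      MDifferentiableAt I 𝓘(ℝ) (fun y ↦ (e x).localFrameCoeff I b i y (σ y)) x :=
    mdifferentiableAt_localFrameCoeff (I := I) b (hmem x) hσ i
  refine ⟨⟨fun σ x ↦ ∑ i, (mvfderiv I (fun y ↦ (e x).localFrameCoeff I b i y (σ y)) x).smulRight
      ((e x).localFrame b i x), ?_, ?_⟩⟩
  · intro σ σ' x hσ hσ' _
    rw [← Finset.sum_add_distrib]
    refine Finset.sum_congr rfl fun i _ ↦ ?_
    ext v
    simp only [Pi.add_apply, map_add]
    rw [mvfderiv_fun_add (hd x σ hσ i) (hd x σ' hσ' i)]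
    simp [add_smul]
  · intro σ g x hσ hg _
    have key := (e x).eq_sum_localFrameCoeff_smul (I := I) (b := b) (s := σ) (hmem x)
    ext v
    simp only [Pi.smul_apply', map_smul, smul_eq_mul]
    simp only [mvfderiv_fun_mul hg (hd x σ hσ _)]
    simp only [add_apply, smul_apply, sum_apply, ContinuousLinearMap.smulRight_apply, add_smul,
      Finset.sum_add_distrib, Finset.smul_sum, smul_eq_mul, mul_smul]
    congr 1
    conv_rhs => rw [key]
    rw [Finset.smul_sum]
    exact Finset.sum_congr rfl fun i _ ↦ by rw [smul_comm]

variable [CompleteSpace E] [RiemannianBundle (fun x : M ↦ TangentSpace I x)]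
  [IsContMDiffRiemannianBundle I ∞ E (fun x : M ↦ TangentSpace I x)]

variable {I M} in
/-- A covariant derivative on the tangent bundle of a Riemannian manifold is a Levi-Civita
connection if it is torsion-free and compatible with the metric. Here `cov τ x v` stands for the
derivative of the vector field `τ` at `x` in the direction `v`. -/
structure IsLeviCivita (cov : CovariantDerivative I E (TangentSpace I : M → Type _)) : Prop where
  torsion_eq_zero : cov.torsion = 0
  mvfderiv_inner {σ τ : Π x : M, TangentSpace I x} {x : M}
    (hσ : MDifferentiableAt I I.tangent (fun y ↦ (⟨y, σ y⟩ : TangentBundle I M)) x)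
    (hτ : MDifferentiableAt I I.tangent (fun y ↦ (⟨y, τ y⟩ : TangentBundle I M)) x)
    (v : TangentSpace I x) :
    mvfderiv I (fun y ↦ inner ℝ (σ y) (τ y)) x v =
      inner ℝ (cov σ x v) (τ x) + inner ℝ (σ x) (cov τ x v)

variable {I M} in
theorem mdifferentiableAt_inner {σ τ : Π x : M, TangentSpace I x} {x : M}
    (hσ : MDifferentiableAt I I.tangent (fun y ↦ (⟨y, σ y⟩ : TangentBundle I M)) x)
    (hτ : MDifferentiableAt I I.tangent (fun y ↦ (⟨y, τ y⟩ : TangentBundle I M)) x) :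
    MDifferentiableAt I 𝓘(ℝ) (fun y ↦ inner ℝ (σ y) (τ y)) x :=
  MDifferentiableAt.inner_bundle (IB := I) (F := E) (E := fun x : M ↦ TangentSpace I x) hσ hτ

/-- Existence of the Levi-Civita connection. -/
theorem exists_isLeviCivita :
    ∃ cov : CovariantDerivative I E (TangentSpace I : M → Type _), IsLeviCivita cov := by
  obtain ⟨D⟩ := exists_covariantDerivative I M
  have hfin (x : M) : FiniteDimensional ℝ (TangentSpace I x) :=
    inferInstanceAs (FiniteDimensional ℝ E)
  let Q (x : M) (v : TangentSpace I x) (σ τ : Π x : M, TangentSpace I x) : ℝ :=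
    mvfderiv I (fun y ↦ inner ℝ (σ y) (τ y)) x v -
      inner ℝ (D σ x v) (τ x) - inner ℝ (σ x) (D τ x v)
  have hQ1 (x v) (τ) (hτ : MDifferentiableAt I I.tangent (fun y ↦ (⟨y, τ y⟩ : TangentBundle I M)) x) :
      TensorialAt I E (Q x v · τ) x := by
    constructor
    · intro f σ hf hσ
      have := mvfderiv_fun_mul hf (mdifferentiableAt_inner hσ hτ)
      simp only [Q, Pi.smul_apply', real_inner_smul_left, this,
        D.isCovariantDerivativeOn.leibniz hσ hf]
      simp [inner_add_left, real_inner_smul_left]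
      ring
    · intro σ σ' hσ hσ'
      have := mvfderiv_fun_add (mdifferentiableAt_inner hσ hτ) (mdifferentiableAt_inner hσ' hτ)
      simp only [Q, Pi.add_apply, inner_add_left, this, D.isCovariantDerivativeOn.add hσ hσ']
      simp [inner_add_left]
      ring
  have hQs (x v σ τ) : Q x v σ τ = Q x v τ σ := by
    simp only [Q, real_inner_comm]
    ring
  have hQ2 (x v) (σ) (hσ : MDifferentiableAt I I.tangent (fun y ↦ (⟨y, σ y⟩ : TangentBundle I M)) x) :
      TensorialAt I E (Q x v σ ·) x := by
    simpa only [hQs x v σ] using hQ1 x v σ hσ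
  let q (x : M) (v : TangentSpace I x) : TangentSpace I x →L[ℝ] TangentSpace I x →L[ℝ] ℝ :=
    TensorialAt.mkHom₂ (Q x v · ·) x (hQ1 x v) (hQ2 x v)
  let t := D.torsion
  let k (x : M) (Y X Z : TangentSpace I x) : ℝ :=
    1 / 2 * (q x X Y Z + q x Y X Z - q x Z X Y - inner ℝ (t x X Y) Z + inner ℝ (t x X Z) Y
      + inner ℝ (t x Y Z) X)
  have hq (x v σ τ hσ hτ) : q x v (σ x) (τ x) = Q x v σ τ :=
    TensorialAt.mkHom₂_apply (hQ1 x v) (hQ2 x v) (σ := σ) (τ := τ) hσ hτ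
  have hext (x : M) (u : TangentSpace I x) : MDifferentiableAt I I.tangent
      (fun y ↦ (⟨y, FiberBundle.extend E u y⟩ : TangentBundle I M)) x :=
    FiberBundle.mdifferentiableAt_extend I E u
  have hqe (x v) (u w : TangentSpace I x) : q x v u w =
      Q x v (FiberBundle.extend E u) (FiberBundle.extend E w) := by
    have := hq x v _ _ (hext x u) (hext x w)
    simpa only [FiberBundle.extend_apply_self] using this
  have hqs (x v) (u w : TangentSpace I x) : q x v u w = q x v w u := by
    rw [hqe, hqe, hQs]
  have hqadd (x) (v v' u w : TangentSpace I x) : q x (v + v') u w = q x v u w + q x v' u w := by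
    simp only [hqe, Q, map_add, inner_add_left, inner_add_right]
    ring
  have hqsmul (x) (c : ℝ) (v u w : TangentSpace I x) : q x (c • v) u w = c * q x v u w := by
    simp only [hqe, Q, map_smul, real_inner_smul_left, real_inner_smul_right, smul_eq_mul]
    ring
  have hA (x : M) : ∃ A : TangentSpace I x →L[ℝ] TangentSpace I x →L[ℝ] TangentSpace I x,
      ∀ Y X Z, inner ℝ (A Y X) Z = k x Y X Z := by
    let e := stdOrthonormalBasis ℝ (TangentSpace I x)
    let A₀ : TangentSpace I x →ₗ[ℝ] TangentSpace I x →ₗ[ℝ] TangentSpace I x :=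
      LinearMap.mk₂ ℝ (fun Y X ↦ ∑ i, k x Y X (e i) • e i)
        (fun Y Y' X ↦ by
          rw [← Finset.sum_add_distrib]
          refine Finset.sum_congr rfl fun i _ ↦ ?_
          rw [← add_smul]
          congr 1
          simp only [k, map_add, add_apply, hqadd, inner_add_left, inner_add_right]
          ring)
        (fun c Y X ↦ by
          rw [Finset.smul_sum]
          refine Finset.sum_congr rfl fun i _ ↦ ?_
          rw [smul_smul]
          congr 1
          simp only [k, map_smul, smul_apply, hqsmul, real_inner_smul_left,
            real_inner_smul_right, smul_eq_mul]
          ring)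
        (fun Y X X' ↦ by
          rw [← Finset.sum_add_distrib]
          refine Finset.sum_congr rfl fun i _ ↦ ?_
          rw [← add_smul]
          congr 1
          simp only [k, map_add, add_apply, hqadd, inner_add_left, inner_add_right]
          ring)
        (fun c Y X ↦ by
          rw [Finset.smul_sum]
          refine Finset.sum_congr rfl fun i _ ↦ ?_
          rw [smul_smul]
          congr 1
          simp only [k, map_smul, smul_apply, hqsmul, real_inner_smul_left,
            real_inner_smul_right, smul_eq_mul]
          ring)
    refine ⟨LinearMap.toContinuousLinearMap
      ((LinearMap.toContinuousLinearMap (𝕜 := ℝ) (E := TangentSpace I x)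
        (F' := TangentSpace I x)).toLinearMap ∘ₗ A₀), fun Y X Z ↦ ?_⟩
    let kl : TangentSpace I x →ₗ[ℝ] ℝ :=
      { toFun := k x Y X
        map_add' := fun Z Z' ↦ by
          simp only [k, map_add, hqadd, inner_add_left, inner_add_right]
          ring
        map_smul' := fun c Z ↦ by
          simp only [k, map_smul, hqsmul, real_inner_smul_left,
            real_inner_smul_right, smul_eq_mul, RingHom.id_apply]
          ring }
    calc inner ℝ (∑ i, k x Y X (e i) • e i) Z
        = ∑ i, inner ℝ (e i) Z * kl (e i) := by
          rw [sum_inner]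
          exact Finset.sum_congr rfl fun i _ ↦ by
            rw [real_inner_smul_left, mul_comm]; rfl
      _ = kl (∑ i, inner ℝ (e i) Z • e i) := by
          rw [map_sum]
          simp only [map_smul, smul_eq_mul]
      _ = k x Y X Z := by
          rw [e.sum_repr']; rfl
  choose A hA using hA
  refine ⟨D.addOneForm A, ?_, ?_⟩
  · rw [CovariantDerivative.torsion_eq_zero_iff]
    intro X Y x hX hY
    have h1 : t x (X x) (Y x) = D Y x (X x) - D X x (Y x) - VectorField.mlieBracket I X Y x :=
      D.torsion_apply hX hY
    have h2 : t x (X x) (Y x) + A x (Y x) (X x) - A x (X x) (Y x) = 0 := by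
      refine ext_inner_right ℝ fun Z ↦ ?_
      rw [inner_sub_left, inner_add_left, hA, hA, inner_zero_left]
      have h3 : t x (Y x) (X x) = - t x (X x) (Y x) := D.torsion_antisymm _ _
      simp only [k, h3, inner_neg_left]
      rw [hqs x Z (X x) (Y x)]
      ring
    rw [h1] at h2
    change D Y x (X x) + A x (Y x) (X x) - (D X x (Y x) + A x (X x) (Y x)) = _
    rw [← sub_eq_zero, ← h2]
    abel
  · intro σ τ x hσ hτ v
    have h1 : q x v (σ x) (τ x) = mvfderiv I (fun y ↦ inner ℝ (σ y) (τ y)) x v -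
      inner ℝ (D σ x v) (τ x) - inner ℝ (σ x) (D τ x v) := hq x v σ τ hσ hτ
    have h2 : inner ℝ (σ x) (A x (τ x) v) = k x (τ x) v (σ x) := by
      rw [real_inner_comm, hA]
    have h3 : t x (τ x) (σ x) = - t x (σ x) (τ x) := D.torsion_antisymm _ _
    change _ = inner ℝ (D σ x v + A x (σ x) v) (τ x) + inner ℝ (σ x) (D τ x v + A x (τ x) v)
    rw [inner_add_left, inner_add_right, h2, hA]
    simp only [k, h3, inner_neg_left]
    rw [hqs x v (τ x) (σ x), hqs x (τ x) v (σ x), hqs x (σ x) v (τ x)]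
    linarith

variable {I M} in
/-- Uniqueness of the Levi-Civita connection on differentiable vector fields. -/
theorem IsLeviCivita.unique {D D' : CovariantDerivative I E (TangentSpace I : M → Type _)}
    (hD : IsLeviCivita D) (hD' : IsLeviCivita D') {σ : Π x : M, TangentSpace I x} {x : M}
    (hσ : MDifferentiableAt I I.tangent (fun y ↦ (⟨y, σ y⟩ : TangentBundle I M)) x) :
    D σ x = D' σ x := by
  have hext (u : TangentSpace I x) : MDifferentiableAt I I.tangent
      (fun y ↦ (⟨y, FiberBundle.extend E u y⟩ : TangentBundle I M)) x :=
    FiberBundle.mdifferentiableAt_extend I E u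
  let A := D.difference D' x
  have hA {τ : Π x : M, TangentSpace I x}
      (hτ : MDifferentiableAt I I.tangent (fun y ↦ (⟨y, τ y⟩ : TangentBundle I M)) x) :
      A (τ x) = D τ x - D' τ x :=
    IsCovariantDerivativeOn.difference_apply _ _ (by trivial) hτ
  have hAe (u : TangentSpace I x) : A u =
      D (FiberBundle.extend E u) x - D' (FiberBundle.extend E u) x := by
    simpa using hA (hext u)
  have hsymm (u v) : A u v = A v u := by
    have h1 := CovariantDerivative.torsion_eq_zero_iff _ |>.1 hD.torsion_eq_zero (hext u) (hext v)
    have h2 := CovariantDerivative.torsion_eq_zero_iff _ |>.1 hD'.torsion_eq_zero (hext u) (hext v)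
    simp only [FiberBundle.extend_apply_self] at h1 h2
    rw [hAe, hAe, sub_apply, sub_apply]
    have := h1.trans h2.symm
    rw [sub_eq_sub_iff_add_eq_add] at this ⊢
    rw [← sub_eq_zero] at this ⊢
    rw [← neg_eq_zero, ← this]
    abel
  have hskew (u v w) : inner ℝ (A u w) v + inner ℝ u (A v w) = 0 := by
    have h1 := hD.mvfderiv_inner (hext u) (hext v) w
    have h2 := hD'.mvfderiv_inner (hext u) (hext v) w
    simp only [FiberBundle.extend_apply_self] at h1 h2
    rw [hAe, hAe, sub_apply, sub_apply, inner_sub_left, inner_sub_right]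
    linarith
  have hzero (u v) : A u v = 0 := by
    refine ext_inner_right ℝ fun w ↦ ?_
    have h1 : inner ℝ (A u v) w + inner ℝ (A w v) u = 0 := by
      rw [real_inner_comm u]; exact hskew u w v
    have h2 : inner ℝ (A u w) v + inner ℝ (A v w) u = 0 := by
      rw [real_inner_comm u]; exact hskew u v w
    have h3 : inner ℝ (A v u) w + inner ℝ (A w u) v = 0 := by
      rw [real_inner_comm v]; exact hskew v w u
    rw [hsymm w v] at h1
    rw [hsymm v u, hsymm w u] at h3
    rw [inner_zero_left]
    linarith
  ext v
  have := hzero (σ x) v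
  rwa [hA hσ, sub_apply, sub_eq_zero] at this

/-- The Levi-Civita connection `∇` of a Riemannian manifold: `leviCivita I M X x v` is the
derivative `∇_v X` of the vector field `X` at the point `x` in the direction `v`. -/
def leviCivita : CovariantDerivative I E (TangentSpace I : M → Type _) :=
  (exists_isLeviCivita I M).choose

theorem isLeviCivita_leviCivita : IsLeviCivita (leviCivita I M) :=
  (exists_isLeviCivita I M).choose_spec

end LeviCivita

section Curvature

variable {F : Type*} [NormedAddCommGroup F] [NormedSpace ℝ F] [FiniteDimensional ℝ F]
  [CompleteSpace F]
  {G : Type*} [TopologicalSpace G] (J : ModelWithCorners ℝ F G)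
  {N : Type*} [TopologicalSpace N] [ChartedSpace G N] [IsManifold J ∞ N]
  [RiemannianBundle (fun y : N ↦ TangentSpace J y)]
  [IsContMDiffRiemannianBundle J ∞ F (fun y : N ↦ TangentSpace J y)]

/-- The curvature tensor `R(u, v)w = ∇_U ∇_V W - ∇_V ∇_U W - ∇_[U, V] W` at the point `y`, where
`U`, `V`, `W` are vector fields, smooth near `y`, which extend the tangent vectors `u`, `v`, `w`
(the value does not depend on the choice of the extensions). -/
def curvature (y : N) (u v w : TangentSpace J y) : TangentSpace J y :=
  let U : Π z : N, TangentSpace J z := FiberBundle.extend F u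
  let V : Π z : N, TangentSpace J z := FiberBundle.extend F v
  let W : Π z : N, TangentSpace J z := FiberBundle.extend F w
  leviCivita J N (fun z ↦ leviCivita J N W z (V z)) y u
    - leviCivita J N (fun z ↦ leviCivita J N W z (U z)) y v
    - leviCivita J N W y (VectorField.mlieBracket J U V y)

/-- The sectional curvature of the plane spanned by the linearly independent vectors `u`, `v`. -/
def sectionalCurvature (y : N) (u v : TangentSpace J y) : ℝ :=
  inner ℝ (curvature J y u v v) u / (‖u‖ ^ 2 * ‖v‖ ^ 2 - inner ℝ u v ^ 2)

variable (N) in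
/-- All sectional curvatures are non-positive. -/
def NonposSectionalCurvature : Prop :=
  ∀ (y : N) (u v : TangentSpace J y), LinearIndependent ℝ ![u, v] → sectionalCurvature J y u v ≤ 0

end Curvature

section Maps

variable {E : Type*} [NormedAddCommGroup E] [NormedSpace ℝ E] [FiniteDimensional ℝ E]
  [CompleteSpace E]
  {H : Type*} [TopologicalSpace H] (I : ModelWithCorners ℝ E H)
  {M : Type*} [TopologicalSpace M] [ChartedSpace H M] [IsManifold I ∞ M]
  [RiemannianBundle (fun x : M ↦ TangentSpace I x)]
  [IsContMDiffRiemannianBundle I ∞ E (fun x : M ↦ TangentSpace I x)]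
  {F : Type*} [NormedAddCommGroup F] [NormedSpace ℝ F] [FiniteDimensional ℝ F]
  [CompleteSpace F]
  {G : Type*} [TopologicalSpace G] (J : ModelWithCorners ℝ F G)
  {N : Type*} [TopologicalSpace N] [ChartedSpace G N] [IsManifold J ∞ N]
  [RiemannianBundle (fun y : N ↦ TangentSpace J y)]
  [IsContMDiffRiemannianBundle J ∞ F (fun y : N ↦ TangentSpace J y)]

theorem finiteDimensional_tangentSpace (x : M) : FiniteDimensional ℝ (TangentSpace I x) :=
  inferInstanceAs (FiniteDimensional ℝ E)

/-- An orthonormal basis `(eᵢ)` of the tangent space at `x`. -/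
def orthonormalBasisAt (x : M) :
    OrthonormalBasis (Fin (finrank ℝ (TangentSpace I x))) ℝ (TangentSpace I x) :=
  haveI := finiteDimensional_tangentSpace I x
  stdOrthonormalBasis ℝ (TangentSpace I x)

/-- The connection induced by the Levi-Civita connection of `N` on the pull-back bundle `φ⁻¹TN`:
the derivative `∇̄_v V` at `x` of a section `V` of `φ⁻¹TN`. In a local frame `(s_a)` of `TN`
around `φ x`, if `V = ∑ Vᵃ (s_a ∘ φ)` then
`∇̄_v V = ∑ (dVᵃ(v) s_a + Vᵃ ∇_{dφ(v)} s_a)`. -/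
def pullbackConnection (φ : M → N) (V : Π x : M, TangentSpace J (φ x)) (x : M) :
    TangentSpace I x →L[ℝ] TangentSpace J (φ x) :=
  let e := trivializationAt F (TangentSpace J : N → Type _) (φ x)
  let b := finBasis ℝ F
  ∑ a, ((mvfderiv I (fun y ↦ e.localFrameCoeff J b a (φ y) (V y)) x).smulRight
        (e.localFrame b a (φ x))
      + e.localFrameCoeff J b a (φ x) (V x) •
        (leviCivita J N (e.localFrame b a) (φ x)).comp (mfderiv I J φ x))

/-- The second fundamental form `B_φ(u, v) = ∇̄_u (dφ(Y)) - dφ(∇_u Y)` of `φ` at `x`, where `Y` is a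
vector field, smooth near `x`, which extends the tangent vector `v` (the value does not depend on
the choice of the extension). -/
def secondFundamentalForm (φ : M → N) (x : M) (u v : TangentSpace I x) : TangentSpace J (φ x) :=
  let Y : Π y : M, TangentSpace I y := FiberBundle.extend E v
  pullbackConnection I J φ (fun y ↦ mfderiv I J φ y (Y y)) x u
    - mfderiv I J φ x (leviCivita I M Y x u)

/-- The tension field `τ(φ) = ∑ B_φ(eᵢ, eᵢ)`. -/
def tensionField (φ : M → N) (x : M) : TangentSpace J (φ x) :=
  ∑ i, secondFundamentalForm I J φ x (orthonormalBasisAt I x i) (orthonormalBasisAt I x i)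

/-- The rough Laplacian `Δ̄V = -∑ (∇̄_{eᵢ} ∇̄_{eᵢ} V - ∇̄_{∇_{eᵢ} eᵢ} V)` of a section `V` of `φ⁻¹TN`.
At the point `x`, the `eᵢ` stand for vector fields, smooth near `x`, which are orthonormal at `x`
(the value does not depend on the choice of these fields). -/
def roughLaplacian (φ : M → N) (V : Π x : M, TangentSpace J (φ x)) (x : M) :
    TangentSpace J (φ x) :=
  - ∑ i,
    let e : Π y : M, TangentSpace I y := FiberBundle.extend E (orthonormalBasisAt I x i)
    pullbackConnection I J φ (fun y ↦ pullbackConnection I J φ V y (e y)) x (e x)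
      - pullbackConnection I J φ V x (leviCivita I M e x (e x))

/-- The operator `𝓡(V) = ∑ R(V, dφ(eᵢ)) dφ(eᵢ)` on sections of `φ⁻¹TN`. -/
def curvatureOperator (φ : M → N) (V : Π x : M, TangentSpace J (φ x)) (x : M) :
    TangentSpace J (φ x) :=
  ∑ i, curvature J (φ x) (V x) (mfderiv I J φ x (orthonormalBasisAt I x i))
    (mfderiv I J φ x (orthonormalBasisAt I x i))

/-- The Jacobi operator `J(V) = Δ̄V - 𝓡(V)`. -/
def jacobiOperator (φ : M → N) (V : Π x : M, TangentSpace J (φ x)) (x : M) :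
    TangentSpace J (φ x) :=
  roughLaplacian I J φ V x - curvatureOperator I J φ V x

/-- The bitension field `τ₂(φ) = J(τ(φ))`. -/
def bitensionField (φ : M → N) (x : M) : TangentSpace J (φ x) :=
  jacobiOperator I J φ (tensionField I J φ) x

/-- A smooth map is harmonic if its tension field vanishes. -/
def IsHarmonic (φ : M → N) : Prop :=
  ContMDiff I J ∞ φ ∧ ∀ x, tensionField I J φ x = 0

/-- A smooth map is biharmonic if its bitension field vanishes. -/
def IsBiharmonic (φ : M → N) : Prop :=
  ContMDiff I J ∞ φ ∧ ∀ x, bitensionField I J φ x = 0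

/-- A smooth map whose differentials preserve the inner products (and are hence injective). -/
def IsIsometricImmersion (φ : M → N) : Prop :=
  ContMDiff I J ∞ φ ∧ ∀ (x : M) (u v : TangentSpace I x),
    inner ℝ (mfderiv I J φ x u) (mfderiv I J φ x v) = inner ℝ u v

/-- The normal space at `φ x`: the orthogonal complement of `dφ(T_x M)` in `T_{φ x} N`. -/
def normalSpace (φ : M → N) (x : M) : Submodule ℝ (TangentSpace J (φ x)) :=
  (LinearMap.range (mfderiv I J φ x).toLinearMap)ᗮ

/-- The normal connection: `∇̄^⊥_v ξ` is the component of `∇̄_v ξ` in the normal space. -/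
def normalConnection (φ : M → N) (ξ : Π x : M, TangentSpace J (φ x)) (x : M)
    (v : TangentSpace I x) : TangentSpace J (φ x) :=
  haveI := finiteDimensional_tangentSpace J (φ x)
  (normalSpace I J φ x).starProjection (pullbackConnection I J φ ξ x v)

/-- The section `ξ` of `φ⁻¹TN` satisfies `∇̄^⊥_X ξ = 0` for all tangent vectors `X` of `M`. -/
def IsNormalParallel (φ : M → N) (ξ : Π x : M, TangentSpace J (φ x)) : Prop :=
  ∀ (x : M) (v : TangentSpace I x), normalConnection I J φ ξ x v = 0

end Maps

end Biharmonic

end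

namespace Biharmonic

section Along

variable {E : Type*} [NormedAddCommGroup E] [NormedSpace ℝ E]
  {H : Type*} [TopologicalSpace H] {I : ModelWithCorners ℝ E H}
  {M : Type*} [TopologicalSpace M] [ChartedSpace H M]
  {F : Type*} [NormedAddCommGroup F] [NormedSpace ℝ F]
  {G : Type*} [TopologicalSpace G] {J : ModelWithCorners ℝ F G}
  {N : Type*} [TopologicalSpace N] [ChartedSpace G N] [IsManifold J ∞ N]
  {φ : M → N} {V W : Π x : M, TangentSpace J (φ x)} {x : M}

/-- The map into the tangent bundle defined by a vector field along a map `φ`. -/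
abbrev along (J : ModelWithCorners ℝ F G) (φ : M → N) (V : Π x : M, TangentSpace J (φ x)) :
    M → TangentBundle J N :=
  fun y ↦ ⟨φ y, V y⟩

/-- The map into the tangent bundle defined by a vector field. -/
abbrev sec (J : ModelWithCorners ℝ F G) (s : Π y : N, TangentSpace J y) : N → TangentBundle J N :=
  fun y ↦ ⟨y, s y⟩

theorem contMDiffAt_along_iff :
    ContMDiffAt I J.tangent ∞ (along J φ V) x ↔ ContMDiffAt I J ∞ φ x ∧
      ContMDiffAt I 𝓘(ℝ, F) ∞ (fun y ↦
        ((trivializationAt F (TangentSpace J : N → Type _) (φ x)) ⟨φ y, V y⟩).2) x :=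
  contMDiffAt_totalSpace

theorem mdifferentiableAt_along_iff :
    MDifferentiableAt I J.tangent (along J φ V) x ↔ MDifferentiableAt I J φ x ∧
      MDifferentiableAt I 𝓘(ℝ, F) (fun y ↦
        ((trivializationAt F (TangentSpace J : N → Type _) (φ x)) ⟨φ y, V y⟩).2) x :=
  mdifferentiableAt_totalSpace ..

theorem eventually_mem_baseSet (hφ : ContinuousAt φ x) :
    ∀ᶠ y in 𝓝 x, φ y ∈ (trivializationAt F (TangentSpace J : N → Type _) (φ x)).baseSet :=
  hφ.eventually_mem ((trivializationAt F (TangentSpace J : N → Type _) (φ x)).open_baseSet.mem_nhds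
    (FiberBundle.mem_baseSet_trivializationAt' _))

theorem trivialization_add_snd {y : N} (e : Trivialization F (π F (TangentSpace J : N → Type _)))
    [e.IsLinear ℝ] (hy : y ∈ e.baseSet) (v w : TangentSpace J y) :
    (e ⟨y, v + w⟩).2 = (e ⟨y, v⟩).2 + (e ⟨y, w⟩).2 :=
  (e.linear ℝ hy).map_add v w

theorem trivialization_smul_snd {y : N} (e : Trivialization F (π F (TangentSpace J : N → Type _)))
    [e.IsLinear ℝ] (hy : y ∈ e.baseSet) (c : ℝ) (v : TangentSpace J y) :
    (e ⟨y, c • v⟩).2 = c • (e ⟨y, v⟩).2 :=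
  (e.linear ℝ hy).map_smul c v

theorem contMDiffAt_along_add (hV : ContMDiffAt I J.tangent ∞ (along J φ V) x)
    (hW : ContMDiffAt I J.tangent ∞ (along J φ W) x) :
    ContMDiffAt I J.tangent ∞ (along J φ (fun y ↦ V y + W y)) x := by
  rw [contMDiffAt_along_iff] at hV hW ⊢
  refine ⟨hV.1, (hV.2.add hW.2).congr_of_eventuallyEq ?_⟩
  filter_upwards [eventually_mem_baseSet (J := J) hV.1.continuousAt] with y hy
  exact trivialization_add_snd _ hy _ _

theorem contMDiffAt_along_smul {f : M → ℝ} (hf : ContMDiffAt I 𝓘(ℝ) ∞ f x)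
    (hV : ContMDiffAt I J.tangent ∞ (along J φ V) x) :
    ContMDiffAt I J.tangent ∞ (along J φ (fun y ↦ f y • V y)) x := by
  rw [contMDiffAt_along_iff] at hV ⊢
  refine ⟨hV.1, (hf.smul hV.2).congr_of_eventuallyEq ?_⟩
  filter_upwards [eventually_mem_baseSet (J := J) hV.1.continuousAt] with y hy
  exact trivialization_smul_snd _ hy _ _

theorem mdifferentiableAt_along_add (hV : MDifferentiableAt I J.tangent (along J φ V) x)
    (hW : MDifferentiableAt I J.tangent (along J φ W) x) :
    MDifferentiableAt I J.tangent (along J φ (fun y ↦ V y + W y)) x := by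
  rw [mdifferentiableAt_along_iff] at hV hW ⊢
  refine ⟨hV.1, (hV.2.add hW.2).congr_of_eventuallyEq ?_⟩
  filter_upwards [eventually_mem_baseSet (J := J) hV.1.continuousAt] with y hy
  exact trivialization_add_snd _ hy _ _

theorem mdifferentiableAt_along_smul {f : M → ℝ} (hf : MDifferentiableAt I 𝓘(ℝ) f x)
    (hV : MDifferentiableAt I J.tangent (along J φ V) x) :
    MDifferentiableAt I J.tangent (along J φ (fun y ↦ f y • V y)) x := by
  rw [mdifferentiableAt_along_iff] at hV ⊢
  refine ⟨hV.1, (hf.smul hV.2).congr_of_eventuallyEq ?_⟩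
  filter_upwards [eventually_mem_baseSet (J := J) hV.1.continuousAt] with y hy
  exact trivialization_smul_snd _ hy _ _

theorem contMDiffAt_along_zero (hφ : ContMDiffAt I J ∞ φ x) :
    ContMDiffAt I J.tangent ∞ (along J φ (fun _ ↦ 0)) x :=
  (contMDiff_zeroSection ℝ (TangentSpace J : N → Type _) (n := ∞) (IB := J)).contMDiffAt.comp x hφ

theorem contMDiffAt_along_sum {ι : Type*} (s : Finset ι) {V : ι → Π x : M, TangentSpace J (φ x)}
    (hφ : ContMDiffAt I J ∞ φ x)
    (hV : ∀ i ∈ s, ContMDiffAt I J.tangent ∞ (along J φ (V i)) x) :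
    ContMDiffAt I J.tangent ∞ (along J φ (fun y ↦ ∑ i ∈ s, V i y)) x := by
  classical
  induction s using Finset.induction_on with
  | empty => simpa using contMDiffAt_along_zero hφ
  | insert i s hi ih =>
    simp only [Finset.sum_insert hi]
    exact contMDiffAt_along_add (hV i (by simp)) (ih fun j hj ↦ hV j (by simp [hj]))

theorem contMDiffAt_along_neg (hV : ContMDiffAt I J.tangent ∞ (along J φ V) x) :
    ContMDiffAt I J.tangent ∞ (along J φ (fun y ↦ - V y)) x := by
  simpa using contMDiffAt_along_smul (f := fun _ ↦ (-1 : ℝ)) contMDiffAt_const hV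

theorem contMDiffAt_along_sub (hV : ContMDiffAt I J.tangent ∞ (along J φ V) x)
    (hW : ContMDiffAt I J.tangent ∞ (along J φ W) x) :
    ContMDiffAt I J.tangent ∞ (along J φ (fun y ↦ V y - W y)) x := by
  simpa only [sub_eq_add_neg] using contMDiffAt_along_add hV (contMDiffAt_along_neg hW)

theorem contMDiffAt_along_comp {s : Π y : N, TangentSpace J y} (hφ : ContMDiffAt I J ∞ φ x)
    (hs : ContMDiffAt J J.tangent ∞ (sec J s) (φ x)) :
    ContMDiffAt I J.tangent ∞ (along J φ (fun y ↦ s (φ y))) x :=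
  hs.comp x hφ

theorem mdifferentiableAt_along_comp {s : Π y : N, TangentSpace J y} (hφ : MDifferentiableAt I J φ x)
    (hs : MDifferentiableAt J J.tangent (sec J s) (φ x)) :
    MDifferentiableAt I J.tangent (along J φ (fun y ↦ s (φ y))) x :=
  hs.comp x hφ

theorem eventually_mdifferentiableAt [IsManifold I ∞ M] {F' G' P : Type*} [NormedAddCommGroup F']
    [NormedSpace ℝ F'] [TopologicalSpace G'] {K : ModelWithCorners ℝ F' G'} [TopologicalSpace P]
    [ChartedSpace G' P] [IsManifold K 1 P] {f : M → P} (hf : ContMDiffAt I K ∞ f x) :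
    ∀ᶠ y in 𝓝 x, MDifferentiableAt I K f y := by
  have : IsManifold I 1 M := .of_le (n := ∞) (by simp)
  filter_upwards [(contMDiffAt_iff_contMDiffAt_nhds (n := 1) (by simp)).1
    (hf.of_le (m := 1) (by simp))] with y hy
  exact hy.mdifferentiableAt (by simp)

variable [FiniteDimensional ℝ F]

theorem localFrameCoeff_along {y : N} (e : Trivialization F (π F (TangentSpace J : N → Type _)))
    [MemTrivializationAtlas e] {ι : Type*} (b : Basis ι ℝ F) (hy : y ∈ e.baseSet)
    (v : TangentSpace J y) (a : ι) :
    e.localFrameCoeff J b a y v = b.repr (e ⟨y, v⟩).2 a := by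
  have := e.localFrameCoeff_apply_of_mem_baseSet (I := J) b hy (FiberBundle.extend F v) a
  rw [FiberBundle.extend_apply_self] at this
  rw [this]
  simp [Trivialization.basisAt]

theorem mdifferentiableAt_localFrameCoeff_along
    (hV : MDifferentiableAt I J.tangent (along J φ V) x) (a) :
    MDifferentiableAt I 𝓘(ℝ) (fun y ↦
      (trivializationAt F (TangentSpace J : N → Type _) (φ x)).localFrameCoeff J
        (finBasis ℝ F) a (φ y) (V y)) x := by
  rw [mdifferentiableAt_along_iff] at hV
  have h := (((finBasis ℝ F).coord a).toContinuousLinearMap.mdifferentiableAt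
    (x := ((trivializationAt F (TangentSpace J : N → Type _) (φ x)) ⟨φ x, V x⟩).2)).comp x hV.2
  refine h.congr_of_eventuallyEq ?_
  filter_upwards [eventually_mem_baseSet (J := J) hV.1.continuousAt] with y hy
  exact localFrameCoeff_along _ _ hy _ _

end Along

section Connection

variable {E : Type*} [NormedAddCommGroup E] [NormedSpace ℝ E] [FiniteDimensional ℝ E]
  [CompleteSpace E]
  {H : Type*} [TopologicalSpace H] {I : ModelWithCorners ℝ E H}
  {M : Type*} [TopologicalSpace M] [ChartedSpace H M] [IsManifold I ∞ M]
  {F : Type*} [NormedAddCommGroup F] [NormedSpace ℝ F] [FiniteDimensional ℝ F]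
  [CompleteSpace F]
  {G : Type*} [TopologicalSpace G] {J : ModelWithCorners ℝ F G}
  {N : Type*} [TopologicalSpace N] [ChartedSpace G N] [IsManifold J ∞ N]
  [RiemannianBundle (fun y : N ↦ TangentSpace J y)]
  [IsContMDiffRiemannianBundle J ∞ F (fun y : N ↦ TangentSpace J y)]
  {φ : M → N} {V W : Π x : M, TangentSpace J (φ x)} {x : M}

theorem mvfderiv_congr {f g : M → ℝ} (h : f =ᶠ[𝓝 x] g) : mvfderiv I f x = mvfderiv I g x := by
  have := h.mfderiv_eq (I := I) (I' := 𝓘(ℝ))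
  simp only [mvfderiv, this]
  rfl

theorem mvfderiv_sum {ι : Type*} (s : Finset ι) {f : ι → M → ℝ}
    (hf : ∀ i ∈ s, MDifferentiableAt I 𝓘(ℝ) (f i) x) :
    MDifferentiableAt I 𝓘(ℝ) (fun y ↦ ∑ i ∈ s, f i y) x ∧
      mvfderiv I (fun y ↦ ∑ i ∈ s, f i y) x = ∑ i ∈ s, mvfderiv I (f i) x := by
  classical
  induction s using Finset.induction_on with
  | empty => exact ⟨by simpa using mdifferentiableAt_const, by simpa using mvfderiv_const 0⟩
  | insert i s hi ih =>
    obtain ⟨h1, h2⟩ := ih fun j hj ↦ hf j (by simp [hj])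
    simp only [Finset.sum_insert hi]
    exact ⟨(hf i (by simp)).add h1, by rw [mvfderiv_fun_add (hf i (by simp)) h1, h2]⟩

theorem mdifferentiableAt_inner_along (hV : MDifferentiableAt I J.tangent (along J φ V) x)
    (hW : MDifferentiableAt I J.tangent (along J φ W) x) :
    MDifferentiableAt I 𝓘(ℝ) (fun y ↦ inner ℝ (V y) (W y)) x :=
  MDifferentiableAt.inner_bundle (IB := J) (F := F) (E := fun x : N ↦ TangentSpace J x) hV hW

theorem contMDiffAt_inner_along (hV : ContMDiffAt I J.tangent ∞ (along J φ V) x)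
    (hW : ContMDiffAt I J.tangent ∞ (along J φ W) x) :
    ContMDiffAt I 𝓘(ℝ) ∞ (fun y ↦ inner ℝ (V y) (W y)) x :=
  ContMDiffAt.inner_bundle (IB := J) (F := F) (E := fun x : N ↦ TangentSpace J x) hV hW

theorem mdifferentiableAt_extend {y : N} (v : TangentSpace J y) :
    MDifferentiableAt J J.tangent (sec J (FiberBundle.extend F v)) y :=
  FiberBundle.mdifferentiableAt_extend J F v

theorem contMDiffAt_extend {y : N} (v : TangentSpace J y) :
    ContMDiffAt J J.tangent ∞ (sec J (FiberBundle.extend F v)) y :=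
  FiberBundle.contMDiffAt_extend J F v

theorem sum_localFrameCoeff_smul {y : N} (e : Trivialization F (π F (TangentSpace J : N → Type _)))
    [MemTrivializationAtlas e] {ι : Type*} [Fintype ι] (b : Basis ι ℝ F) (hy : y ∈ e.baseSet)
    (v : TangentSpace J y) :
    ∑ a, e.localFrameCoeff J b a y v • e.localFrame b a y = v := by
  have := e.eq_sum_localFrameCoeff_smul (I := J) (b := b) (s := FiberBundle.extend F v) hy
  rw [FiberBundle.extend_apply_self] at this
  exact this.symm

theorem mvfderiv_inner_comp_frame {s t : Π y : N, TangentSpace J y}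
    (hφ : MDifferentiableAt I J φ x)
    (hs : MDifferentiableAt J J.tangent (sec J s) (φ x))
    (ht : MDifferentiableAt J J.tangent (sec J t) (φ x)) (v : TangentSpace I x) :
    mvfderiv I (fun y ↦ inner ℝ (s (φ y)) (t (φ y))) x v =
      inner ℝ (leviCivita J N s (φ x) (mfderiv I J φ x v)) (t (φ x)) +
      inner ℝ (s (φ x)) (leviCivita J N t (φ x) (mfderiv I J φ x v)) := by
  rw [← (isLeviCivita_leviCivita J N).mvfderiv_inner hs ht]
  exact mvfderiv_comp_apply x (mdifferentiableAt_inner_along hs ht) hφ v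

theorem mdifferentiableAt_of_along (hV : MDifferentiableAt I J.tangent (along J φ V) x) :
    MDifferentiableAt I J φ x := (mdifferentiableAt_along_iff.1 hV).1

theorem mdifferentiableAt_localFrame (y : N) (a) :
    MDifferentiableAt J J.tangent (sec J
      ((trivializationAt F (TangentSpace J : N → Type _) y).localFrame (finBasis ℝ F) a)) y :=
  (contMDiffAt_localFrame_of_mem 1 _ _ a
    (FiberBundle.mem_baseSet_trivializationAt' y)).mdifferentiableAt one_ne_zero

theorem pullbackConnection_apply (V : Π x : M, TangentSpace J (φ x)) (x : M)
    (v : TangentSpace I x) :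
    pullbackConnection I J φ V x v =
      ∑ a, ((mvfderiv I (fun y ↦ (trivializationAt F (TangentSpace J : N → Type _)
        (φ x)).localFrameCoeff J (finBasis ℝ F) a (φ y) (V y)) x v) •
        (trivializationAt F (TangentSpace J : N → Type _) (φ x)).localFrame (finBasis ℝ F) a (φ x)
      + (trivializationAt F (TangentSpace J : N → Type _) (φ x)).localFrameCoeff J
          (finBasis ℝ F) a (φ x) (V x) •
        leviCivita J N ((trivializationAt F (TangentSpace J : N → Type _)
          (φ x)).localFrame (finBasis ℝ F) a) (φ x) (mfderiv I J φ x v)) := by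
  simp [pullbackConnection]

theorem mvfderiv_inner_comp {s : Π y : N, TangentSpace J y}
    (hs : MDifferentiableAt J J.tangent (sec J s) (φ x))
    (hW : MDifferentiableAt I J.tangent (along J φ W) x) (v : TangentSpace I x) :
    mvfderiv I (fun y ↦ inner ℝ (s (φ y)) (W y)) x v =
      inner ℝ (leviCivita J N s (φ x) (mfderiv I J φ x v)) (W x) +
      inner ℝ (s (φ x)) (pullbackConnection I J φ W x v) := by
  have hφ := mdifferentiableAt_of_along hW
  have hmem := FiberBundle.mem_baseSet_trivializationAt' (F := F)
    (E := (TangentSpace J : N → Type _)) (φ x)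
  have hc := mdifferentiableAt_localFrameCoeff_along hW
  have hl := mdifferentiableAt_localFrame (J := J) (φ x)
  set e := trivializationAt F (TangentSpace J : N → Type _) (φ x)
  set b := finBasis ℝ F
  have hi a := mdifferentiableAt_inner_along (mdifferentiableAt_along_comp hφ hs)
    (mdifferentiableAt_along_comp hφ (hl a))
  have h1 : (fun y ↦ inner ℝ (s (φ y)) (W y)) =ᶠ[𝓝 x] fun y ↦
      ∑ a, e.localFrameCoeff J b a (φ y) (W y) * inner ℝ (s (φ y)) (e.localFrame b a (φ y)) := by
    filter_upwards [eventually_mem_baseSet (J := J) hφ.continuousAt] with y hy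
    conv_lhs => rw [← sum_localFrameCoeff_smul e b hy (W y)]
    simp only [inner_sum, real_inner_smul_right]
  have hm a : MDifferentiableAt I 𝓘(ℝ) (fun y ↦ e.localFrameCoeff J b a (φ y) (W y) *
      inner ℝ (s (φ y)) (e.localFrame b a (φ y))) x := (hc a).mul (hi a)
  rw [mvfderiv_congr h1, (mvfderiv_sum _ fun a _ ↦ hm a).2, pullbackConnection_apply]
  conv_rhs => enter [1]; rw [← sum_localFrameCoeff_smul e b hmem (W x)]
  rw [inner_sum, inner_sum, ← Finset.sum_add_distrib, sum_apply]
  refine Finset.sum_congr rfl fun a _ ↦ ?_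
  rw [mvfderiv_fun_mul (hc a) (hi a)]
  simp only [add_apply, smul_apply, smul_eq_mul, inner_add_right, real_inner_smul_right]
  rw [mvfderiv_inner_comp_frame hφ hs (hl a)]
  ring

/-- The induced connection is compatible with the metric. -/
theorem mvfderiv_inner_along (hV : MDifferentiableAt I J.tangent (along J φ V) x)
    (hW : MDifferentiableAt I J.tangent (along J φ W) x) (v : TangentSpace I x) :
    mvfderiv I (fun y ↦ inner ℝ (V y) (W y)) x v =
      inner ℝ (pullbackConnection I J φ V x v) (W x) +
      inner ℝ (V x) (pullbackConnection I J φ W x v) := by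
  have hφ := mdifferentiableAt_of_along hW
  have hmem := FiberBundle.mem_baseSet_trivializationAt' (F := F)
    (E := (TangentSpace J : N → Type _)) (φ x)
  have hc := mdifferentiableAt_localFrameCoeff_along hV
  have hl := mdifferentiableAt_localFrame (J := J) (φ x)
  set e := trivializationAt F (TangentSpace J : N → Type _) (φ x)
  set b := finBasis ℝ F
  have hi a := mdifferentiableAt_inner_along (mdifferentiableAt_along_comp hφ (hl a)) hW
  have h1 : (fun y ↦ inner ℝ (V y) (W y)) =ᶠ[𝓝 x] fun y ↦
      ∑ a, e.localFrameCoeff J b a (φ y) (V y) * inner ℝ (e.localFrame b a (φ y)) (W y) := by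
    filter_upwards [eventually_mem_baseSet (J := J) hφ.continuousAt] with y hy
    conv_lhs => rw [← sum_localFrameCoeff_smul e b hy (V y)]
    simp only [sum_inner, real_inner_smul_left]
  have hm a : MDifferentiableAt I 𝓘(ℝ) (fun y ↦ e.localFrameCoeff J b a (φ y) (V y) *
      inner ℝ (e.localFrame b a (φ y)) (W y)) x := (hc a).mul (hi a)
  rw [mvfderiv_congr h1, (mvfderiv_sum _ fun a _ ↦ hm a).2,
    pullbackConnection_apply V]
  conv_rhs => enter [2]; rw [← sum_localFrameCoeff_smul e b hmem (V x)]
  rw [sum_inner, sum_inner, ← Finset.sum_add_distrib, sum_apply]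
  refine Finset.sum_congr rfl fun a _ ↦ ?_
  rw [mvfderiv_fun_mul (hc a) (hi a)]
  simp only [add_apply, smul_apply, smul_eq_mul, inner_add_left, real_inner_smul_left]
  rw [mvfderiv_inner_comp (hl a) hW]
  ring

/-- A formula which characterizes the induced connection. -/
theorem inner_pullbackConnection (hV : MDifferentiableAt I J.tangent (along J φ V) x)
    (w : TangentSpace J (φ x)) (v : TangentSpace I x) :
    inner ℝ w (pullbackConnection I J φ V x v) =
      mvfderiv I (fun y ↦ inner ℝ (FiberBundle.extend F w (φ y)) (V y)) x v -
      inner ℝ (leviCivita J N (FiberBundle.extend F w) (φ x) (mfderiv I J φ x v)) (V x) := by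
  rw [mvfderiv_inner_comp (mdifferentiableAt_extend w) hV, FiberBundle.extend_apply_self]
  ring

theorem pullbackConnection_add (hV : MDifferentiableAt I J.tangent (along J φ V) x)
    (hW : MDifferentiableAt I J.tangent (along J φ W) x) :
    pullbackConnection I J φ (fun y ↦ V y + W y) x =
      pullbackConnection I J φ V x + pullbackConnection I J φ W x := by
  ext v
  refine ext_inner_left ℝ fun w ↦ ?_
  have he := mdifferentiableAt_along_comp (mdifferentiableAt_of_along hV)
    (mdifferentiableAt_extend w)
  rw [add_apply, inner_add_right, inner_pullbackConnection hV, inner_pullbackConnection hW,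
    inner_pullbackConnection (mdifferentiableAt_along_add hV hW)]
  simp only [inner_add_right]
  rw [mvfderiv_fun_add (mdifferentiableAt_inner_along he hV) (mdifferentiableAt_inner_along he hW)]
  simp only [add_apply]
  ring

theorem pullbackConnection_smul {f : M → ℝ} (hf : MDifferentiableAt I 𝓘(ℝ) f x)
    (hV : MDifferentiableAt I J.tangent (along J φ V) x) (v : TangentSpace I x) :
    pullbackConnection I J φ (fun y ↦ f y • V y) x v =
      mvfderiv I f x v • V x + f x • pullbackConnection I J φ V x v := by
  refine ext_inner_left ℝ fun w ↦ ?_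
  have he := mdifferentiableAt_along_comp (mdifferentiableAt_of_along hV)
    (mdifferentiableAt_extend w)
  rw [inner_add_right, real_inner_smul_right, real_inner_smul_right, inner_pullbackConnection hV,
    inner_pullbackConnection (mdifferentiableAt_along_smul hf hV)]
  simp only [real_inner_smul_right]
  rw [mvfderiv_fun_mul hf (mdifferentiableAt_inner_along he hV)]
  simp only [add_apply, smul_apply, smul_eq_mul, FiberBundle.extend_apply_self]
  ring

end Connection

section Frame

variable {E : Type*} [NormedAddCommGroup E] [NormedSpace ℝ E] [FiniteDimensional ℝ E]
  [CompleteSpace E]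
  {H : Type*} [TopologicalSpace H] {I : ModelWithCorners ℝ E H}
  {M : Type*} [TopologicalSpace M] [ChartedSpace H M] [IsManifold I ∞ M]
  {F : Type*} [NormedAddCommGroup F] [NormedSpace ℝ F] [FiniteDimensional ℝ F]
  [CompleteSpace F]
  {G : Type*} [TopologicalSpace G] {J : ModelWithCorners ℝ F G}
  {N : Type*} [TopologicalSpace N] [ChartedSpace G N] [IsManifold J ∞ N]
  {φ : M → N} {x : M}

theorem isManifold_tangentBundle : IsManifold J.tangent 1 (TangentBundle J N) := by
  have : IsManifold J (1 + 1) N := by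
    rw [one_add_one_eq_two]
    infer_instance
  infer_instance

theorem contMDiffAt_mfderiv {X : Π y : M, TangentSpace I y} (hφ : ContMDiffAt I J ∞ φ x)
    (hX : ContMDiffAt I I.tangent ∞ (sec I X) x) :
    ContMDiffAt I J.tangent ∞ (along J φ (fun y ↦ mfderiv I J φ y (X y))) x :=
  ContMDiffAt.clm_apply_of_inCoordinates (F₁ := E) (E₁ := fun y : M ↦ TangentSpace I y)
    (F₂ := F) (E₂ := fun y : N ↦ TangentSpace J y) (b₁ := id) (b₂ := φ)
    (hφ.mfderiv_const (m := ∞) (by simp)) hX hφ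

theorem mdifferentiableAt_mfderiv {X : Π y : M, TangentSpace I y} (hφ : ContMDiffAt I J ∞ φ x)
    (hX : MDifferentiableAt I I.tangent (sec I X) x) :
    MDifferentiableAt I J.tangent (along J φ (fun y ↦ mfderiv I J φ y (X y))) x :=
  MDifferentiableAt.clm_apply_of_inCoordinates (F₁ := E) (E₁ := fun y : M ↦ TangentSpace I y)
    (F₂ := F) (E₂ := fun y : N ↦ TangentSpace J y) (b₁ := id) (b₂ := φ)
    ((hφ.mfderiv_const (m := ∞) (by simp)).mdifferentiableAt (by simp)) hX
    (hφ.mdifferentiableAt (by simp))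

theorem contMDiffAt_mvfderiv {f : M → ℝ} {X : Π y : M, TangentSpace I y}
    (hf : ContMDiffAt I 𝓘(ℝ) ∞ f x) (hX : ContMDiffAt I I.tangent ∞ (sec I X) x) :
    ContMDiffAt I 𝓘(ℝ) ∞ (fun y ↦ mvfderiv I f y (X y)) x := by
  have := (contMDiffAt_along_iff.1 (contMDiffAt_mfderiv hf hX)).2
  simpa using! this

variable [RiemannianBundle (fun y : N ↦ TangentSpace J y)]
  [IsContMDiffRiemannianBundle J ∞ F (fun y : N ↦ TangentSpace J y)]

open InnerProductSpace in
theorem contMDiffAt_gramSchmidt {k : ℕ} {s : Fin k → Π y : N, TangentSpace J y} {y₀ : N}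
    (hs : ∀ i, ContMDiffAt J J.tangent ∞ (sec J (s i)) y₀)
    (hl : LinearIndependent ℝ fun i ↦ s i y₀) (i : Fin k) :
    ContMDiffAt J J.tangent ∞ (sec J fun y ↦ gramSchmidt ℝ (fun j ↦ s j y) i) y₀ := by
  induction i using WellFoundedLT.induction with
  | _ i ih =>
    have hd : (sec J fun y ↦ gramSchmidt ℝ (fun j ↦ s j y) i) = sec J fun y ↦ s i y -
        ∑ j ∈ Finset.Iio i, (inner ℝ (gramSchmidt ℝ (fun j ↦ s j y) j) (s i y) /
          inner ℝ (gramSchmidt ℝ (fun j ↦ s j y) j) (gramSchmidt ℝ (fun j ↦ s j y) j)) •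
            gramSchmidt ℝ (fun j ↦ s j y) j := by
      funext y
      simp only [sec]
      rw [gramSchmidt_def]
      simp [Submodule.starProjection_singleton]
    rw [hd]
    refine contMDiffAt_along_sub (φ := id) (hs i)
      (contMDiffAt_along_sum (φ := id) _ contMDiffAt_id fun j hj ↦ ?_)
    have hj := ih j (Finset.mem_Iio.1 hj)
    refine contMDiffAt_along_smul (φ := id) ?_ hj
    have h0 := gramSchmidt_ne_zero (f := fun j ↦ s j y₀) j hl
    exact (contMDiffAt_inner_along (φ := id) hj (hs i)).div₀
      (contMDiffAt_inner_along (φ := id) hj hj) (by simpa using h0)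

/-- Every point of a Riemannian manifold has a neighbourhood with a smooth orthonormal frame. -/
theorem exists_orthonormal_frame (y₀ : N) :
    ∃ ε : Fin (finrank ℝ F) → Π y : N, TangentSpace J y,
      (∀ i, ContMDiffAt J J.tangent ∞ (sec J (ε i)) y₀) ∧
      ∀ᶠ y in 𝓝 y₀, ∃ b : OrthonormalBasis (Fin (finrank ℝ F)) ℝ (TangentSpace J y),
        ∀ i, b i = ε i y := by
  let e := trivializationAt F (TangentSpace J : N → Type _) y₀
  let b := finBasis ℝ F
  have hmem : y₀ ∈ e.baseSet := FiberBundle.mem_baseSet_trivializationAt' y₀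
  have hl : ∀ y ∈ e.baseSet, LinearIndependent ℝ fun i ↦ e.localFrame b i y :=
    fun y hy ↦ (e.isLocalFrameOn_localFrame_baseSet J 1 b).linearIndependent hy
  have hs (i) : ContMDiffAt J J.tangent ∞ (sec J (e.localFrame b i)) y₀ :=
    contMDiffAt_localFrame_of_mem ∞ _ _ i hmem
  refine ⟨fun i y ↦ InnerProductSpace.gramSchmidtNormed ℝ (fun j ↦ e.localFrame b j y) i,
    fun i ↦ ?_, ?_⟩
  · have hg := contMDiffAt_gramSchmidt hs (hl y₀ hmem) i
    have h0 := InnerProductSpace.gramSchmidt_ne_zero (f := fun j ↦ e.localFrame b j y₀) i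
      (hl y₀ hmem)
    refine contMDiffAt_along_smul (φ := id) ?_ hg
    simp only [norm_eq_sqrt_real_inner, RCLike.ofReal_real_eq_id, id]
    refine ContMDiffAt.inv₀ ?_ ?_
    · refine ContMDiffAt.comp (g := Real.sqrt) (I' := 𝓘(ℝ)) _ ?_
        (contMDiffAt_inner_along (φ := id) hg hg)
      exact (Real.contDiffAt_sqrt (by simpa using h0)).contMDiffAt
    · simpa [← norm_eq_sqrt_real_inner] using h0
  · filter_upwards [e.open_baseSet.mem_nhds hmem] with y hy
    have ho := InnerProductSpace.gramSchmidtNormed_orthonormal (hl y hy)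
    have hc : Fintype.card (Fin (finrank ℝ F)) = finrank ℝ (TangentSpace J y) := by
      simp; rfl
    have := finiteDimensional_tangentSpace J y
    exact ⟨OrthonormalBasis.mk ho (ho.linearIndependent.span_eq_top_of_card_eq_finrank' hc).ge,
      fun i ↦ by simp⟩

theorem contMDiffAt_along_of_inner {V : Π x : M, TangentSpace J (φ x)}
    {ε : Fin (finrank ℝ F) → Π y : N, TangentSpace J y} (hφ : ContMDiffAt I J ∞ φ x)
    (hε : ∀ i, ContMDiffAt J J.tangent ∞ (sec J (ε i)) (φ x))
    (hb : ∀ᶠ y in 𝓝 (φ x), ∃ b : OrthonormalBasis (Fin (finrank ℝ F)) ℝ (TangentSpace J y),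
        ∀ i, b i = ε i y)
    (h : ∀ i, ContMDiffAt I 𝓘(ℝ) ∞ (fun y ↦ inner ℝ (ε i (φ y)) (V y)) x) :
    ContMDiffAt I J.tangent ∞ (along J φ V) x := by
  have := contMDiffAt_along_sum Finset.univ hφ
    (fun i _ ↦ contMDiffAt_along_smul (h i) (contMDiffAt_along_comp hφ (hε i)))
  refine this.congr_of_eventuallyEq ?_
  filter_upwards [hφ.continuousAt.eventually hb] with y ⟨b, hb⟩
  simp only [along, ← hb, b.sum_repr']

theorem contMDiffAt_mlieBracket {X Y : Π y : N, TangentSpace J y} {y : N}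
    (hX : ContMDiffAt J J.tangent ∞ (sec J X) y) (hY : ContMDiffAt J J.tangent ∞ (sec J Y) y) :
    ContMDiffAt J J.tangent ∞ (sec J (VectorField.mlieBracket J X Y)) y := by
  have : IsManifold J ((⊤ : ℕ∞) + 1) N := by simpa
  have : IsManifold J (minSmoothness ℝ 2) N := by
    rw [minSmoothness_of_isRCLikeNormedField]
    infer_instance
  exact ContMDiffAt.mlieBracket_vectorField (m := ⊤) (n := ⊤) hX hY (by simp)

theorem leviCivita_sub_leviCivita {X Y : Π y : N, TangentSpace J y} {y : N}
    (hX : MDifferentiableAt J J.tangent (sec J X) y)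
    (hY : MDifferentiableAt J J.tangent (sec J Y) y) :
    leviCivita J N Y y (X y) - leviCivita J N X y (Y y) = VectorField.mlieBracket J X Y y :=
  (CovariantDerivative.torsion_eq_zero_iff _).1 (isLeviCivita_leviCivita J N).torsion_eq_zero hX hY

/-- The Koszul formula. -/
theorem koszul {X Y Z : Π y : N, TangentSpace J y} {y : N}
    (hX : MDifferentiableAt J J.tangent (sec J X) y)
    (hY : MDifferentiableAt J J.tangent (sec J Y) y)
    (hZ : MDifferentiableAt J J.tangent (sec J Z) y) :
    inner ℝ (Z y) (leviCivita J N Y y (X y)) =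
      1 / 2 * (mvfderiv J (fun z ↦ inner ℝ (Y z) (Z z)) y (X y)
        + mvfderiv J (fun z ↦ inner ℝ (X z) (Z z)) y (Y y)
        - mvfderiv J (fun z ↦ inner ℝ (X z) (Y z)) y (Z y)
        + inner ℝ (VectorField.mlieBracket J X Y y) (Z y)
        - inner ℝ (VectorField.mlieBracket J X Z y) (Y y)
        - inner ℝ (VectorField.mlieBracket J Y Z y) (X y)) := by
  have hL := isLeviCivita_leviCivita J N
  rw [hL.mvfderiv_inner hY hZ, hL.mvfderiv_inner hX hZ, hL.mvfderiv_inner hX hY,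
    ← leviCivita_sub_leviCivita hX hY, ← leviCivita_sub_leviCivita hX hZ,
    ← leviCivita_sub_leviCivita hY hZ]
  simp only [inner_sub_left]
  simp only [real_inner_comm (Z y), real_inner_comm (Y y), real_inner_comm (X y)]
  ring

theorem contMDiffAt_leviCivita {X Y : Π y : N, TangentSpace J y} {y : N}
    (hX : ContMDiffAt J J.tangent ∞ (sec J X) y) (hY : ContMDiffAt J J.tangent ∞ (sec J Y) y) :
    ContMDiffAt J J.tangent ∞ (sec J fun z ↦ leviCivita J N Y z (X z)) y := by
  obtain ⟨ε, hε, hb⟩ := exists_orthonormal_frame (J := J) y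
  refine contMDiffAt_along_of_inner (φ := id) contMDiffAt_id hε hb fun i ↦ ?_
  have hi {U V : Π y : N, TangentSpace J y} (hU : ContMDiffAt J J.tangent ∞ (sec J U) y)
    (hV : ContMDiffAt J J.tangent ∞ (sec J V) y) :
    ContMDiffAt J 𝓘(ℝ) ∞ (fun z ↦ inner ℝ (U z) (V z)) y := contMDiffAt_inner_along (φ := id) hU hV
  have hZ := hε i
  have h1 := (((((contMDiffAt_mvfderiv (hi hY hZ) hX).add (contMDiffAt_mvfderiv (hi hX hZ) hY)).sub
    (contMDiffAt_mvfderiv (hi hX hY) hZ)).add (hi (contMDiffAt_mlieBracket hX hY) hZ)).sub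
    (hi (contMDiffAt_mlieBracket hX hZ) hY)).sub (hi (contMDiffAt_mlieBracket hY hZ) hX)
  refine ((contMDiffAt_const (c := (1 / 2 : ℝ))).mul h1).congr_of_eventuallyEq ?_
  have := isManifold_tangentBundle (J := J) (N := N)
  filter_upwards [eventually_mdifferentiableAt hX, eventually_mdifferentiableAt hY,
    eventually_mdifferentiableAt hZ] with z h1 h2 h3
  exact koszul h1 h2 h3

/-- The derivative of a smooth vector field along a map is smooth. -/
theorem contMDiffAt_pullbackConnection {V : Π x : M, TangentSpace J (φ x)}
    {X : Π y : M, TangentSpace I y} (hV : ContMDiffAt I J.tangent ∞ (along J φ V) x)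
    (hX : ContMDiffAt I I.tangent ∞ (sec I X) x) :
    ContMDiffAt I J.tangent ∞ (along J φ fun y ↦ pullbackConnection I J φ V y (X y)) x := by
  have hφ := (contMDiffAt_along_iff.1 hV).1
  obtain ⟨ε, hε, hb⟩ := exists_orthonormal_frame (J := J) (φ x)
  have := isManifold_tangentBundle (J := J) (N := N)
  have : IsManifold J 1 N := .of_le (n := ∞) (by simp)
  have hdφ := contMDiffAt_mfderiv hφ hX
  have hεφ i := contMDiffAt_along_comp hφ (hε i)
  have hL (i) : ContMDiffAt I J.tangent ∞
      (along J φ fun y ↦ leviCivita J N (ε i) (φ y) (mfderiv I J φ y (X y))) x := by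
    refine (contMDiffAt_along_sum Finset.univ hφ fun j _ ↦ contMDiffAt_along_smul
      (contMDiffAt_inner_along (hεφ j) hdφ)
      (contMDiffAt_along_comp hφ (contMDiffAt_leviCivita (hε j) (hε i)))).congr_of_eventuallyEq ?_
    filter_upwards [hφ.continuousAt.eventually hb] with y ⟨b, hb⟩
    simp only [along]
    congr 1
    conv_lhs => rw [← b.sum_repr' (mfderiv I J φ y (X y)), map_sum]
    simp only [hb, map_smul]
  refine contMDiffAt_along_of_inner hφ hε hb fun i ↦ ?_
  refine ((contMDiffAt_mvfderiv (contMDiffAt_inner_along (hεφ i) hV) hX).sub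
    (contMDiffAt_inner_along (hL i) hV)).congr_of_eventuallyEq ?_
  filter_upwards [eventually_mdifferentiableAt hV,
    hφ.continuousAt.eventually (eventually_mdifferentiableAt (hε i))] with y h1 h2
  simp only [mvfderiv_inner_comp h2 h1]
  simp

end Frame

section Symmetry

variable {E : Type*} [NormedAddCommGroup E] [NormedSpace ℝ E] [FiniteDimensional ℝ E]
  [CompleteSpace E]
  {H : Type*} [TopologicalSpace H] {I : ModelWithCorners ℝ E H}
  {M : Type*} [TopologicalSpace M] [ChartedSpace H M] [IsManifold I ∞ M]
  {F : Type*} [NormedAddCommGroup F] [NormedSpace ℝ F] [FiniteDimensional ℝ F]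
  [CompleteSpace F]
  {G : Type*} [TopologicalSpace G] {J : ModelWithCorners ℝ F G}
  {N : Type*} [TopologicalSpace N] [ChartedSpace G N] [IsManifold J ∞ N]
  {φ : M → N} {x : M}

theorem extend_apply_eq {y : M} (hy : y ∈ (chartAt H x).source) (u : TangentSpace I x) :
    FiberBundle.extend E u y =
      mfderivWithin 𝓘(ℝ, E) I (extChartAt I x).symm (Set.range I) (extChartAt I x y)
        ((trivializationAt E (TangentSpace I : M → Type _) x) ⟨x, u⟩).2 :=
  (Trivialization.symmL_apply (R := ℝ) _ (by simpa using hy) _).symm.trans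
    (DFunLike.congr_fun (TangentBundle.symmL_trivializationAt (I := I) hy) _)

theorem eventually_mpullbackWithin_extend (u : TangentSpace I x) :
    VectorField.mpullbackWithin 𝓘(ℝ, E) I (extChartAt I x).symm (FiberBundle.extend E u)
      (Set.range I) =ᶠ[𝓝[Set.range I] (extChartAt I x x)] fun _ ↦
        ((trivializationAt E (TangentSpace I : M → Type _) x) ⟨x, u⟩).2 := by
  filter_upwards [extChartAt_target_mem_nhdsWithin x] with z hz
  have hz' : (extChartAt I x).symm z ∈ (chartAt H x).source := by
    simpa using (extChartAt I x).map_target hz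
  rw [VectorField.mpullbackWithin_apply, extend_apply_eq hz', (extChartAt I x).right_inv hz]
  exact (isInvertible_mfderivWithin_extChartAt_symm hz).inverse_apply_eq.2 rfl

theorem mlieBracket_extend (u v : TangentSpace I x) :
    VectorField.mlieBracket I (FiberBundle.extend E u) (FiberBundle.extend E v) x = 0 := by
  rw [← VectorField.mlieBracketWithin_univ, VectorField.mlieBracketWithin_apply, Set.preimage_univ,
    Set.univ_inter, (eventually_mpullbackWithin_extend u).lieBracketWithin_vectorField_eq_of_mem
      (eventually_mpullbackWithin_extend v) (by simp)]
  have h0 (w w' z : E) : VectorField.lieBracketWithin ℝ (fun _ ↦ w) (fun _ ↦ w') (Set.range I) z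
      = 0 := by simp [VectorField.lieBracketWithin]
  exact (congrArg _ (h0 _ _ _)).trans (map_zero _)

theorem eventually_localFrame_eq_extend (a) :
    ∀ᶠ y in 𝓝 x, (trivializationAt E (TangentSpace I : M → Type _) x).localFrame (finBasis ℝ E) a y
      = FiberBundle.extend E ((trivializationAt E (TangentSpace I : M → Type _) x).localFrame
        (finBasis ℝ E) a x) y := by
  have hx := FiberBundle.mem_baseSet_trivializationAt' (F := E)
    (E := (TangentSpace I : M → Type _)) x
  have h {y : M} (hy : y ∈ (trivializationAt E (TangentSpace I : M → Type _) x).baseSet) :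
      (trivializationAt E (TangentSpace I : M → Type _) x).localFrame (finBasis ℝ E) a y =
      (trivializationAt E (TangentSpace I : M → Type _) x).symm y (finBasis ℝ E a) := by
    rw [Trivialization.localFrame_apply_of_mem_baseSet _ _ hy]
    simp [Trivialization.basisAt]
  filter_upwards [(trivializationAt E (TangentSpace I : M → Type _) x).open_baseSet.mem_nhds hx]
    with y hy
  rw [h hy, h hx, FiberBundle.extend, Trivialization.apply_mk_symm _ hx]

theorem mlieBracket_localFrame (a b) :
    VectorField.mlieBracket I
      ((trivializationAt E (TangentSpace I : M → Type _) x).localFrame (finBasis ℝ E) a)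
      ((trivializationAt E (TangentSpace I : M → Type _) x).localFrame (finBasis ℝ E) b) x = 0 := by
  rw [Filter.EventuallyEq.mlieBracket_vectorField_eq (eventually_localFrame_eq_extend a)
    (eventually_localFrame_eq_extend b), mlieBracket_extend]

variable [I.Boundaryless]

theorem contDiffAt_writtenInExtChartAt (hφ : ContMDiffAt I J ∞ φ x) :
    ContDiffAt ℝ ∞ (writtenInExtChartAt I J x φ) (extChartAt I x x) := by
  have := (contMDiffAt_iff.1 hφ).2
  rw [I.range_eq_univ, contDiffWithinAt_univ] at this
  exact this

theorem mfderiv_extChartAt_comp {y : M} (hy : y ∈ (chartAt H x).source)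
    (hyφ : φ y ∈ (chartAt G (φ x)).source) (hφ : MDifferentiableAt I J φ y) (v : E) :
    mfderiv J 𝓘(ℝ, F) (extChartAt J (φ x)) (φ y) (mfderiv I J φ y
      (mfderivWithin 𝓘(ℝ, E) I (extChartAt I x).symm (Set.range I) (extChartAt I x y) v)) =
    fderiv ℝ (writtenInExtChartAt I J x φ) (extChartAt I x y) v := by
  have hy' : y ∈ (extChartAt I x).source := by simpa using hy
  have hs : MDifferentiableAt 𝓘(ℝ, E) I (extChartAt I x).symm (extChartAt I x y) := by
    have := mdifferentiableWithinAt_extChartAt_symm ((extChartAt I x).map_source hy')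
    rwa [I.range_eq_univ, mdifferentiableWithinAt_univ] at this
  have hl : (extChartAt I x).symm (extChartAt I x y) = y := (extChartAt I x).left_inv hy'
  have hc : MDifferentiableAt 𝓘(ℝ, E) J (φ ∘ (extChartAt I x).symm) (extChartAt I x y) :=
    MDifferentiableAt.comp_of_eq _ hφ hs hl
  rw [← mfderiv_eq_fderiv, I.range_eq_univ, mfderivWithin_univ]
  refine Eq.trans ?_ (mfderiv_comp_apply_of_eq _ (mdifferentiableAt_extChartAt hyφ) hc
    (congrArg φ hl) _).symm
  exact congrArg _ (mfderiv_comp_apply_of_eq _ hφ hs hl _).symm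

/-- In charts, the derivative of `dφ(Y)`, where `Y` has constant coefficients, is given by the
second derivative of `φ`. -/
theorem mvfderiv_mfderiv_extend (hφ : ContMDiffAt I J ∞ φ x) (a) (u v : TangentSpace I x) :
    mvfderiv I (fun y ↦ (trivializationAt F (TangentSpace J : N → Type _)
        (φ x)).localFrameCoeff J (finBasis ℝ F) a (φ y)
          (mfderiv I J φ y (FiberBundle.extend E v y))) x u =
      (finBasis ℝ F).coord a
        (fderiv ℝ (fderiv ℝ (writtenInExtChartAt I J x φ)) (extChartAt I x x) u v) := by
  set g := writtenInExtChartAt I J x φ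
  have hgs : ContDiffAt ℝ ∞ g (extChartAt I x x) := 
    contDiffAt_writtenInExtChartAt hφ
  have hg' : DifferentiableAt ℝ (fderiv ℝ g) (extChartAt I x x) :=
    (hgs.fderiv_right (m := 1) (by rw [one_add_one_eq_two]; exact ENat.LEInfty.out)).differentiableAt (by norm_num)
  let L : (E →L[ℝ] F) →L[ℝ] ℝ := ((finBasis ℝ F).coord a).toContinuousLinearMap.comp
    (ContinuousLinearMap.apply ℝ F (show E from v))
  have hself : ((trivializationAt E (TangentSpace I : M → Type _) x) ⟨x, v⟩).2 = v := by
    have h1 := TangentBundle.continuousLinearMapAt_trivializationAt (I := I)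
      (mem_chart_source H x)
    rw [mfderiv_extChartAt_self] at h1
    rw [← Trivialization.continuousLinearMapAt_apply_of_mem (R := ℝ) _
      (FiberBundle.mem_baseSet_trivializationAt' x), h1]
    rfl
  have h1 : (fun y ↦ (trivializationAt F (TangentSpace J : N → Type _)
        (φ x)).localFrameCoeff J (finBasis ℝ F) a (φ y)
          (mfderiv I J φ y (FiberBundle.extend E v y))) =ᶠ[𝓝 x]
      (fun z ↦ L (fderiv ℝ g z)) ∘ extChartAt I x := by
    have : IsManifold J 1 N := .of_le (n := ∞) (by simp)
    filter_upwards [eventually_mem_baseSet (J := J) hφ.continuousAt,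
      (chartAt H x).open_source.mem_nhds (mem_chart_source H x),
      eventually_mdifferentiableAt hφ] with y hy hyx hyφ
    have hyN : φ y ∈ (chartAt G (φ x)).source := by simpa using hy
    rw [localFrameCoeff_along _ _ hy]
    simp only [Function.comp_apply, L, ContinuousLinearMap.comp_apply,
      LinearMap.coe_toContinuousLinearMap', Basis.coord_apply]
    congr 2
    rw [extend_apply_eq hyx, hself]
    refine Eq.trans ?_ (mfderiv_extChartAt_comp hyx hyN hyφ v)
    exact (Trivialization.continuousLinearMapAt_apply_of_mem (R := ℝ) _ hy _).symm.trans
      (DFunLike.congr_fun (TangentBundle.continuousLinearMapAt_trivializationAt hyN) _)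
  rw [mvfderiv_congr h1]
  have h2 : HasFDerivAt (fun z ↦ L (fderiv ℝ g z))
    (L.comp (fderiv ℝ (fderiv ℝ g) (extChartAt I x x))) (extChartAt I x x) :=
    L.hasFDerivAt.comp _ hg'.hasFDerivAt
  rw [mvfderiv_comp_apply x h2.differentiableAt.mdifferentiableAt
    (mdifferentiableAt_extChartAt (mem_chart_source H x)), mfderiv_extChartAt_self]
  simp only [mvfderiv, mfderiv_eq_fderiv, h2.fderiv]
  rfl

variable [RiemannianBundle (fun x : M ↦ TangentSpace I x)]
  [IsContMDiffRiemannianBundle I ∞ E (fun x : M ↦ TangentSpace I x)]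
  [RiemannianBundle (fun y : N ↦ TangentSpace J y)]
  [IsContMDiffRiemannianBundle J ∞ F (fun y : N ↦ TangentSpace J y)]

theorem leviCivita_localFrame_comm (y : N) (a b) :
    leviCivita J N ((trivializationAt F (TangentSpace J : N → Type _) y).localFrame
        (finBasis ℝ F) a) y
      ((trivializationAt F (TangentSpace J : N → Type _) y).localFrame (finBasis ℝ F) b y) =
    leviCivita J N ((trivializationAt F (TangentSpace J : N → Type _) y).localFrame
        (finBasis ℝ F) b) y
      ((trivializationAt F (TangentSpace J : N → Type _) y).localFrame (finBasis ℝ F) a y) := by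
  rw [← sub_eq_zero, leviCivita_sub_leviCivita (mdifferentiableAt_localFrame y b)
    (mdifferentiableAt_localFrame y a), mlieBracket_localFrame]

theorem secondFundamentalForm_symm (hφ : ContMDiffAt I J ∞ φ x) (u v : TangentSpace I x) :
    secondFundamentalForm I J φ x u v = secondFundamentalForm I J φ x v u := by
  have h1 : leviCivita I M (FiberBundle.extend E v) x u =
      leviCivita I M (FiberBundle.extend E u) x v := by
    have := leviCivita_sub_leviCivita (J := I) (mdifferentiableAt_extend u)
      (mdifferentiableAt_extend v)
    simpa [mlieBracket_extend, sub_eq_zero] using this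
  have hgs : ContDiffAt ℝ ∞ (writtenInExtChartAt I J x φ) (extChartAt I x x) := 
    contDiffAt_writtenInExtChartAt hφ
  have hsymm := hgs.isSymmSndFDerivAt
    (by rw [minSmoothness_of_isRCLikeNormedField]; exact ENat.LEInfty.out)
  have key (u v : TangentSpace I x) : pullbackConnection I J φ
      (fun y ↦ mfderiv I J φ y (FiberBundle.extend E v y)) x u =
      ∑ a, (finBasis ℝ F).coord a (fderiv ℝ (fderiv ℝ (writtenInExtChartAt I J x φ))
          (extChartAt I x x) u v) •
        (trivializationAt F (TangentSpace J : N → Type _) (φ x)).localFrame (finBasis ℝ F) a (φ x)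
      + ∑ a, ∑ b, ((trivializationAt F (TangentSpace J : N → Type _) (φ x)).localFrameCoeff J
          (finBasis ℝ F) a (φ x) (mfderiv I J φ x v) *
        (trivializationAt F (TangentSpace J : N → Type _) (φ x)).localFrameCoeff J
          (finBasis ℝ F) b (φ x) (mfderiv I J φ x u)) •
        leviCivita J N ((trivializationAt F (TangentSpace J : N → Type _)
          (φ x)).localFrame (finBasis ℝ F) a) (φ x)
          ((trivializationAt F (TangentSpace J : N → Type _)
          (φ x)).localFrame (finBasis ℝ F) b (φ x)) := by
    rw [pullbackConnection_apply, Finset.sum_add_distrib]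
    simp only [mvfderiv_mfderiv_extend hφ, FiberBundle.extend_apply_self]
    congr 1
    refine Finset.sum_congr rfl fun a _ ↦ ?_
    conv_lhs => rw [← sum_localFrameCoeff_smul _ (finBasis ℝ F)
      (FiberBundle.mem_baseSet_trivializationAt' (φ x)) (mfderiv I J φ x u), map_sum]
    simp only [map_smul, Finset.smul_sum, mul_smul]
  simp only [secondFundamentalForm, h1, key]
  congr 2
  · exact Finset.sum_congr rfl fun a _ ↦
      congrArg (fun w : F ↦ (finBasis ℝ F).coord a w • _) (hsymm u v)
  · rw [Finset.sum_comm]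
    refine Finset.sum_congr rfl fun b _ ↦ Finset.sum_congr rfl fun a _ ↦ ?_
    rw [leviCivita_localFrame_comm, mul_comm]

end Symmetry

section Isometric

variable {E : Type*} [NormedAddCommGroup E] [NormedSpace ℝ E] [FiniteDimensional ℝ E]
  [CompleteSpace E]
  {H : Type*} [TopologicalSpace H] {I : ModelWithCorners ℝ E H}
  {M : Type*} [TopologicalSpace M] [ChartedSpace H M] [IsManifold I ∞ M]
  [RiemannianBundle (fun x : M ↦ TangentSpace I x)]
  [IsContMDiffRiemannianBundle I ∞ E (fun x : M ↦ TangentSpace I x)]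
  {F : Type*} [NormedAddCommGroup F] [NormedSpace ℝ F] [FiniteDimensional ℝ F]
  [CompleteSpace F]
  {G : Type*} [TopologicalSpace G] {J : ModelWithCorners ℝ F G}
  {N : Type*} [TopologicalSpace N] [ChartedSpace G N] [IsManifold J ∞ N]
  [RiemannianBundle (fun y : N ↦ TangentSpace J y)]
  [IsContMDiffRiemannianBundle J ∞ F (fun y : N ↦ TangentSpace J y)]
  {φ : M → N} {x : M}

theorem tensorialAt_secondFundamentalForm (hφ : ContMDiffAt I J ∞ φ x) (u : TangentSpace I x) :
    TensorialAt I E (fun Y : Π y : M, TangentSpace I y ↦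
      pullbackConnection I J φ (fun y ↦ mfderiv I J φ y (Y y)) x u
        - mfderiv I J φ x (leviCivita I M Y x u)) x where
  smul {f Y} hf hY := by
    simp only [Pi.smul_apply', map_smul]
    rw [pullbackConnection_smul hf (mdifferentiableAt_mfderiv hφ hY),
      (leviCivita I M).isCovariantDerivativeOnUniv.leibniz hY hf]
    simp only [add_apply, smul_apply, ContinuousLinearMap.smulRight_apply, map_add, map_smul,
      smul_sub]
    abel
  add {Y Z} hY hZ := by
    simp only [Pi.add_apply, map_add]
    rw [pullbackConnection_add (mdifferentiableAt_mfderiv hφ hY) (mdifferentiableAt_mfderiv hφ hZ),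
      (leviCivita I M).isCovariantDerivativeOnUniv.add hY hZ]
    simp only [add_apply, map_add]
    abel

theorem secondFundamentalForm_eq (hφ : ContMDiffAt I J ∞ φ x) {Y : Π y : M, TangentSpace I y}
    (hY : MDifferentiableAt I I.tangent (sec I Y) x) (u : TangentSpace I x) :
    secondFundamentalForm I J φ x u (Y x) =
      pullbackConnection I J φ (fun y ↦ mfderiv I J φ y (Y y)) x u
        - mfderiv I J φ x (leviCivita I M Y x u) :=
  TensorialAt.mkHom_apply (tensorialAt_secondFundamentalForm hφ u) hY

/-- The trace of the second fundamental form does not depend on the orthonormal basis. -/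
theorem tensionField_eq_sum (hφ : ContMDiffAt I J ∞ φ x) {ι : Type*} [Fintype ι]
    (b : OrthonormalBasis ι ℝ (TangentSpace I x)) :
    tensionField I J φ x = ∑ i, secondFundamentalForm I J φ x (b i) (b i) := by
  have := finiteDimensional_tangentSpace I x
  let L (u : TangentSpace I x) := TensorialAt.mkHom _ x (tensorialAt_secondFundamentalForm hφ u)
  have hL (u v) : secondFundamentalForm I J φ x u v = L u v := rfl
  let B : TangentSpace I x →ₗ[ℝ] TangentSpace I x →ₗ[ℝ] TangentSpace J (φ x) :=
    LinearMap.mk₂ ℝ (secondFundamentalForm I J φ x)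
      (fun u u' v ↦ by simp only [secondFundamentalForm, map_add]; abel)
      (fun c u v ↦ by simp only [secondFundamentalForm, map_smul, smul_sub])
      (fun u v v' ↦ by simp only [hL, map_add])
      (fun c u v ↦ by simp only [hL, map_smul])
  have h₁ := congrArg (TensorProduct.lift B)
    (InnerProductSpace.canonicalCovariantTensor_eq_sum _ (orthonormalBasisAt I x))
  have h₂ := congrArg (TensorProduct.lift B)
    (InnerProductSpace.canonicalCovariantTensor_eq_sum _ b)
  rw [map_sum] at h₁ h₂
  exact h₁.symm.trans h₂

/-- The tension field is smooth. -/
theorem contMDiffAt_tensionField (hφ : ContMDiff I J ∞ φ) :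
    ContMDiffAt I J.tangent ∞ (along J φ (tensionField I J φ)) x := by
  obtain ⟨ε, hε, hb⟩ := exists_orthonormal_frame (J := I) x
  have := isManifold_tangentBundle (J := I) (N := M)
  have hs := contMDiffAt_along_sum Finset.univ (hφ x) fun i _ ↦ contMDiffAt_along_sub
    (contMDiffAt_pullbackConnection (contMDiffAt_mfderiv (hφ x) (hε i)) (hε i))
    (contMDiffAt_mfderiv (hφ x) (contMDiffAt_leviCivita (hε i) (hε i)))
  refine hs.congr_of_eventuallyEq ?_
  filter_upwards [hb, Filter.eventually_all.2 fun i ↦ eventually_mdifferentiableAt (hε i)]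
    with y ⟨b, hb⟩ hd
  simp only [along, tensionField_eq_sum (hφ y) b, hb]
  congr 1
  exact Finset.sum_congr rfl fun i _ ↦ secondFundamentalForm_eq (hφ y) (hd i) _

theorem inner_secondFundamentalForm_skew (hφ : IsIsometricImmersion I J φ)
    (u v w : TangentSpace I x) :
    inner ℝ (secondFundamentalForm I J φ x u v) (mfderiv I J φ x w) =
      - inner ℝ (secondFundamentalForm I J φ x u w) (mfderiv I J φ x v) := by
  have hd (v : TangentSpace I x) := mdifferentiableAt_extend (J := I) v
  have h1 := mvfderiv_inner_along (mdifferentiableAt_mfderiv (hφ.1 x) (hd v))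
    (mdifferentiableAt_mfderiv (hφ.1 x) (hd w)) u
  simp only [hφ.2] at h1
  rw [(isLeviCivita_leviCivita I M).mvfderiv_inner (hd v) (hd w) u] at h1
  simp only [FiberBundle.extend_apply_self] at h1
  simp only [secondFundamentalForm, inner_sub_left, hφ.2]
  rw [real_inner_comm _ (mfderiv I J φ x v)] at h1
  rw [real_inner_comm _ v] at h1
  linarith

variable [I.Boundaryless]

/-- The tension field of an isometric immersion is normal. -/
theorem inner_tensionField_mfderiv (hφ : IsIsometricImmersion I J φ) (w : TangentSpace I x) :
    inner ℝ (tensionField I J φ x) (mfderiv I J φ x w) = 0 := by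
  rw [tensionField, sum_inner]
  refine Finset.sum_eq_zero fun i _ ↦ ?_
  set e := orthonormalBasisAt I x i
  have h1 := inner_secondFundamentalForm_skew (x := x) hφ e e w
  have h2 := inner_secondFundamentalForm_skew (x := x) hφ w e e
  rw [secondFundamentalForm_symm (hφ.1 x) e w] at h1
  linarith

theorem inner_pullbackConnection_tensionField (hφ : IsIsometricImmersion I J φ)
    (hτ : IsNormalParallel I J φ (tensionField I J φ)) (v : TangentSpace I x) :
    inner ℝ (pullbackConnection I J φ (tensionField I J φ) x v) (tensionField I J φ x) = 0 := by
  have := finiteDimensional_tangentSpace J (φ x)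
  have hn : tensionField I J φ x ∈ normalSpace I J φ x := by
    rw [normalSpace, Submodule.mem_orthogonal]
    rintro _ ⟨w, rfl⟩
    rw [real_inner_comm]
    exact inner_tensionField_mfderiv hφ w
  have h := hτ x v
  rw [normalConnection] at h
  rw [← Submodule.starProjection_eq_self_iff.2 hn, ← Submodule.inner_starProjection_left_eq_right,
    h, inner_zero_left]

theorem inner_roughLaplacian_tensionField (hφ : IsIsometricImmersion I J φ)
    (hτ : IsNormalParallel I J φ (tensionField I J φ)) :
    inner ℝ (roughLaplacian I J φ (tensionField I J φ) x) (tensionField I J φ x) =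
      ∑ i, ‖pullbackConnection I J φ (tensionField I J φ) x (orthonormalBasisAt I x i)‖ ^ 2 := by
  have hs := contMDiffAt_tensionField (x := x) hφ.1
  simp only [roughLaplacian, inner_neg_left, sum_inner, ← Finset.sum_neg_distrib, inner_sub_left,
    inner_pullbackConnection_tensionField hφ hτ, sub_zero]
  refine Finset.sum_congr rfl fun i _ ↦ ?_
  have h1 := mvfderiv_inner_along ((contMDiffAt_pullbackConnection hs
    (contMDiffAt_extend (J := I) (orthonormalBasisAt I x i))).mdifferentiableAt (by simp))
    (hs.mdifferentiableAt (by simp)) (orthonormalBasisAt I x i)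
  simp only [inner_pullbackConnection_tensionField hφ hτ, FiberBundle.extend_apply_self,
    mvfderiv_const, real_inner_self_eq_norm_sq, zero_apply] at h1
  rw [FiberBundle.extend_apply_self]
  linarith

theorem inner_curvatureOperator_tensionField_nonpos (hN : NonposSectionalCurvature J N)
    (hφ : IsIsometricImmersion I J φ) (hx : tensionField I J φ x ≠ 0) :
    inner ℝ (curvatureOperator I J φ (tensionField I J φ) x) (tensionField I J φ x) ≤ 0 := by
  rw [curvatureOperator, sum_inner]
  refine Finset.sum_nonpos fun i _ ↦ ?_
  set u := tensionField I J φ x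
  set v := mfderiv I J φ x (orthonormalBasisAt I x i)
  have huv : inner ℝ u v = 0 := inner_tensionField_mfderiv hφ _
  have hv : ‖v‖ = 1 := by
    rw [norm_eq_sqrt_real_inner, hφ.2, ← norm_eq_sqrt_real_inner]
    exact (orthonormalBasisAt I x).norm_eq_one i
  have hv0 : v ≠ 0 := by
    rw [← norm_ne_zero_iff, hv]
    exact one_ne_zero
  have hl : LinearIndependent ℝ ![u, v] := by
    rw [LinearIndependent.pair_iff]
    intro s t hst
    have h1 : inner ℝ u (s • u + t • v) = 0 := by rw [hst, inner_zero_right]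
    have h2 : inner ℝ (s • u + t • v) v = 0 := by rw [hst, inner_zero_left]
    rw [inner_add_right, real_inner_smul_right, real_inner_smul_right, huv] at h1
    rw [inner_add_left, real_inner_smul_left, real_inner_smul_left, huv] at h2
    constructor
    · simpa [hx] using h1
    · simpa [hv0] using h2
  have h := hN _ u v hl
  rw [sectionalCurvature, huv, hv] at h
  have hu : 0 < ‖u‖ ^ 2 := by positivity
  by_contra! hpos
  exact absurd h (not_le.2 (div_pos hpos (by simpa using hu)))

/-- A biharmonic isometric immersion with parallel tension field into a manifold of non-positive
curvature is harmonic. -/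
theorem tensionField_eq_zero_of_bitensionField_eq_zero (hN : NonposSectionalCurvature J N)
    (hφ : IsIsometricImmersion I J φ) (hτ : IsNormalParallel I J φ (tensionField I J φ))
    (hbi : bitensionField I J φ x = 0) : tensionField I J φ x = 0 := by
  by_contra hx
  have h1 : inner ℝ (bitensionField I J φ x) (tensionField I J φ x) = 0 := by
    rw [hbi, inner_zero_left]
  rw [bitensionField, jacobiOperator, inner_sub_left, inner_roughLaplacian_tensionField hφ hτ]
    at h1
  have h2 := inner_curvatureOperator_tensionField_nonpos hN hφ hx
  have h3 : ∑ i, ‖pullbackConnection I J φ (tensionField I J φ) x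
      (orthonormalBasisAt I x i)‖ ^ 2 = 0 :=
    le_antisymm (by linarith) (Finset.sum_nonneg fun i _ ↦ by positivity)
  rw [Finset.sum_eq_zero_iff_of_nonneg fun i _ ↦ by positivity] at h3
  apply hx
  rw [← inner_self_eq_zero (𝕜 := ℝ)]
  conv_lhs => enter [3]; rw [tensionField]
  rw [inner_sum]
  refine Finset.sum_eq_zero fun i hi ↦ ?_
  set e := orthonormalBasisAt I x i
  have h4 : pullbackConnection I J φ (tensionField I J φ) x e = 0 := by simpa using h3 i hi
  have h5 := mvfderiv_inner_along
    ((contMDiffAt_tensionField (x := x) hφ.1).mdifferentiableAt (by simp))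
    (mdifferentiableAt_mfderiv (hφ.1 x) (mdifferentiableAt_extend (J := I) e)) e
  simp only [inner_tensionField_mfderiv hφ, mvfderiv_const, h4, inner_zero_left, zero_add,
    zero_apply] at h5
  rw [secondFundamentalForm, inner_sub_right, inner_tensionField_mfderiv hφ, ← h5, sub_zero]

end Isometric

end Biharmonic

theorem corollary3p3 (m n : ℕ)
    {M : Type*} [TopologicalSpace M] [ChartedSpace (EuclideanSpace ℝ (Fin m)) M]
    [IsManifold (𝓡 m) ∞ M]
    [RiemannianBundle (fun x : M ↦ TangentSpace (𝓡 m) x)]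
    [IsContMDiffRiemannianBundle (𝓡 m) ∞ (EuclideanSpace ℝ (Fin m))
      (fun x : M ↦ TangentSpace (𝓡 m) x)]
    {N : Type*} [TopologicalSpace N] [ChartedSpace (EuclideanSpace ℝ (Fin n)) N]
    [IsManifold (𝓡 n) ∞ N]
    [RiemannianBundle (fun y : N ↦ TangentSpace (𝓡 n) y)]
    [IsContMDiffRiemannianBundle (𝓡 n) ∞ (EuclideanSpace ℝ (Fin n))
      (fun y : N ↦ TangentSpace (𝓡 n) y)]
    (hN : Biharmonic.NonposSectionalCurvature (𝓡 n) N)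
    (φ : M → N) (hφ : Biharmonic.IsIsometricImmersion (𝓡 m) (𝓡 n) φ)
    (hτ : Biharmonic.IsNormalParallel (𝓡 m) (𝓡 n) φ (Biharmonic.tensionField (𝓡 m) (𝓡 n) φ))
    (hbi : Biharmonic.IsBiharmonic (𝓡 m) (𝓡 n) φ) :
    Biharmonic.IsHarmonic (𝓡 m) (𝓡 n) φ := by
  exact ⟨hφ.1, fun x ↦
    Biharmonic.tensionField_eq_zero_of_bitensionField_eq_zero hN hφ hτ (hbi.2 x)⟩
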